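/- Let $\mathbb{S}^n$ denote the space of real symmetric $n\times n$ matrices with inner product $A\bullet B=\mathrm{Tr}(AB^\top)$ and Frobenius norm $\|\cdot\|_F$, let $\|\cdot\|$ denote the spectral norm (largest singular value), and for $A\in\mathbb{S}^n$ let $\lambda_1(A)\ge\dots\ge\lambda_n(A)$ denote its eigenvalues, counted with multiplicity. Let $\mathcal{S}_n=\{X\in\mathbb{S}^n : X\succeq 0,\ \mathrm{Tr}(X)=1\}$ be the spectrahedron and let $\Pi_{\mathcal{S}_n}[M]$ denote the Euclidean (Frobenius-nearest-point) projection of a matrix $M$ onto $\mathcal{S}_n$. Let $f:\mathbb{S}^n\to\mathbb{R}$ be convex and $\beta$-smooth for some $\beta\ge 0$, i.e., $f$ is differentiable and $\|\nabla f(X)-\nabla f(Y)\|_F\le\beta\|X-Y\|_F$ for all $X,Y\in\mathbb{S}^n$. Let $X^*\in\mathcal{S}_n$ be an optimal solution of $\min_{X\in\mathcal{S}_n}f(X)$ with $\mathrm{rank}(X^*)=r<n$, let $\mu_1\ge\dots\ge\mu_n$ be the eigenvalues of $\nabla f(X^*)$, and let $\delta:=\mu_{n-r}-\mu_n$. Let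 $B>0$ and $\xi\in\mathbb{R}$. Let $X\in\mathcal{S}_n$ satisfy $\mathrm{rank}(X)\le r$ and $$\|X-X^*\|_F\le\frac14\Big(r\beta+\frac{\sqrt{2r}\,B}{\lambda_r(X^*)}\Big)^{-1}(\delta-4r\xi).$$ Finally, let $\widetilde\nabla$ be a real $n\times n$ matrix with $\|\widetilde\nabla-\nabla f(X)\|\le\xi$ and $\|\widetilde\nabla\|\le B$. Then for every step size $\eta>0$, $$\mathrm{rank}\big(\Pi_{\mathcal{S}_n}[X-\eta\widetilde\nabla]\big)\le r.$$ -/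

import Mathlib

open scoped Matrix.Norms.Frobenius

noncomputable section

namespace Spectrahedron

/-- The Frobenius inner product `A • B = Tr (A Bᵀ)`; it induces the Frobenius norm, which is the
norm `‖·‖` on matrices throughout. -/
instance frobeniusInner (n : ℕ) : InnerProductSpace ℝ (Matrix (Fin n) (Fin n) ℝ) where
  inner A B := (A * B.transpose).trace
  norm_sq_eq_re_inner A := by
    have h : ‖A‖ ^ 2 = ∑ i, ∑ j, A i j ^ 2 := by
      rw [Matrix.frobenius_norm_def, ← Real.sqrt_eq_rpow, Real.sq_sqrt]
      · simp
      · exact Finset.sum_nonneg fun i _ => Finset.sum_nonneg fun j _ => by positivity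
    rw [h]
    simp [Matrix.trace, Matrix.mul_apply, sq]
  conj_inner_symm A B := by
    simp only [conj_trivial]
    rw [← Matrix.trace_transpose, Matrix.transpose_mul, Matrix.transpose_transpose]
  add_left A B C := by simp [Matrix.add_mul]
  smul_left A B c := by simp

/-- The subspace of symmetric matrices in the space of all real `n × n` matrices. -/
def symSubmodule (n : ℕ) : Submodule ℝ (Matrix (Fin n) (Fin n) ℝ) where
  carrier := {A | A.IsSymm}
  add_mem' hA hB := hA.add hB
  zero_mem' := Matrix.isSymm_zero
  smul_mem' c _ hA := hA.smul c

/-- The space `𝕊ⁿ` of real symmetric `n × n` matrices, a Euclidean space with the Frobenius inner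
product inherited from the space of all matrices. -/
def SymMat (n : ℕ) : Type := symSubmodule n

instance (n : ℕ) : NormedAddCommGroup (SymMat n) :=
  inferInstanceAs (NormedAddCommGroup (symSubmodule n))

instance (n : ℕ) : InnerProductSpace ℝ (SymMat n) :=
  inferInstanceAs (InnerProductSpace ℝ (symSubmodule n))

instance (n : ℕ) : FiniteDimensional ℝ (SymMat n) :=
  inferInstanceAs (FiniteDimensional ℝ (symSubmodule n))

instance (n : ℕ) : CompleteSpace (SymMat n) := FiniteDimensional.complete ℝ (SymMat n)

/-- The matrix underlying an element of `𝕊ⁿ`. -/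
def SymMat.toMat {n : ℕ} (A : SymMat n) : Matrix (Fin n) (Fin n) ℝ := A.1

lemma SymMat.isHermitian {n : ℕ} (A : SymMat n) : A.toMat.IsHermitian := by
  have h : A.toMat.transpose = A.toMat := A.2
  rwa [Matrix.IsHermitian, Matrix.conjTranspose_eq_transpose_of_trivial]

/-- `eig A k` is the `k`-th eigenvalue `λ_k(A)`, `1 ≤ k ≤ n`, of the symmetric matrix `A`, where
`λ₁(A) ≥ ⋯ ≥ λₙ(A)` are the eigenvalues with multiplicity in non-increasing order (Mathlib's
`eigenvalues₀` is antitone and indexed from `0`). Outside that range of `k` the value is `0`. -/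
def eig {n : ℕ} (A : SymMat n) (k : ℕ) : ℝ :=
  if h : 1 ≤ k ∧ k ≤ n then
    A.isHermitian.eigenvalues₀ ⟨k - 1, by rw [Fintype.card_fin]; omega⟩
  else 0

/-- The spectral norm (largest singular value) of a matrix: the operator norm of the induced map on
Euclidean space. -/
def specNorm {n : ℕ} (A : Matrix (Fin n) (Fin n) ℝ) : ℝ :=
  ‖Matrix.toEuclideanCLM (n := Fin n) (𝕜 := ℝ) A‖

/-- The spectrahedron `𝒮ₙ`: positive semidefinite symmetric matrices of trace `1`. -/
def spectrahedron (n : ℕ) : Set (Matrix (Fin n) (Fin n) ℝ) :=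
  {X | X.PosSemidef ∧ X.trace = 1}

/-- `P` is a nearest point to `M` in the spectrahedron, in the Frobenius norm. -/
def IsProj {n : ℕ} (M P : Matrix (Fin n) (Fin n) ℝ) : Prop :=
  P ∈ spectrahedron n ∧ ∀ Q ∈ spectrahedron n, ‖M - P‖ ≤ ‖M - Q‖

open Classical in
/-- The Euclidean projection `Π_{𝒮ₙ}[M]` onto the spectrahedron. For `n ≥ 1` it is the unique
nearest point, see `isProj_proj` and `IsProj.eq_proj`. -/
def proj {n : ℕ} (M : Matrix (Fin n) (Fin n) ℝ) : Matrix (Fin n) (Fin n) ℝ :=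
  if h : ∃ P, IsProj M P then h.choose else 0

lemma convex_spectrahedron (n : ℕ) : Convex ℝ (spectrahedron n) := by
  rintro X ⟨hX, hX1⟩ Y ⟨hY, hY1⟩ a b ha hb hab
  exact ⟨(hX.smul ha).add (hY.smul hb), by simp [hX1, hY1, hab]⟩

lemma isClosed_spectrahedron (n : ℕ) : IsClosed (spectrahedron n) := by
  have h : spectrahedron n = {X | X.transpose = X} ∩
      (⋂ v : Fin n → ℝ, {X | 0 ≤ dotProduct v (X.mulVec v)}) ∩ {X | X.trace = 1} := by
    ext X
    simp only [spectrahedron, Matrix.posSemidef_iff_dotProduct_mulVec, Matrix.IsHermitian,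
      Matrix.conjTranspose_eq_transpose_of_trivial, star_trivial, Set.mem_ofPred_eq,
      Set.mem_inter_iff, Set.mem_iInter]
  rw [h]
  refine ((isClosed_eq (by fun_prop) (by fun_prop)).inter (isClosed_iInter fun v => ?_)).inter
    (isClosed_eq (by fun_prop) (by fun_prop))
  exact isClosed_le (by fun_prop) (by fun_prop)

lemma spectrahedron_nonempty {n : ℕ} (hn : 0 < n) : (spectrahedron n).Nonempty := by
  have hn' : (n : ℝ) ≠ 0 := by positivity
  refine ⟨(n : ℝ)⁻¹ • 1, Matrix.PosSemidef.one.smul (by positivity), ?_⟩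
  simp [hn']

/-- For `n ≥ 1` the projection onto the spectrahedron exists. -/
lemma isProj_proj {n : ℕ} (hn : 0 < n) (M : Matrix (Fin n) (Fin n) ℝ) : IsProj M (proj M) := by
  obtain ⟨P, hP, hmin⟩ := exists_norm_eq_iInf_of_complete_convex (spectrahedron_nonempty hn)
    (isClosed_spectrahedron n).isComplete (convex_spectrahedron n) M
  have h : ∃ P, IsProj M P := by
    refine ⟨P, hP, fun Q hQ => ?_⟩
    rw [hmin]
    exact ciInf_le ⟨0, by rintro _ ⟨_, rfl⟩; positivity⟩ (⟨Q, hQ⟩ : spectrahedron n)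
  rw [proj, dif_pos h]
  exact h.choose_spec

/-- The projection onto the spectrahedron is unique. -/
lemma IsProj.unique {n : ℕ} {M P Q : Matrix (Fin n) (Fin n) ℝ} (hP : IsProj M P)
    (hQ : IsProj M Q) : P = Q := by
  have heq : ‖M - P‖ = ‖M - Q‖ := le_antisymm (hP.2 _ hQ.1) (hQ.2 _ hP.1)
  have hm := hP.2 _ (convex_spectrahedron n hP.1 hQ.1 (by norm_num : (0 : ℝ) ≤ 1 / 2)
    (by norm_num : (0 : ℝ) ≤ 1 / 2) (by norm_num))
  have e1 : M - ((1 / 2 : ℝ) • P + (1 / 2 : ℝ) • Q) = (1 / 2 : ℝ) • ((M - P) + (M - Q)) := by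
    module
  have e2 : (M - P) - (M - Q) = Q - P := by abel
  have hp := parallelogram_law_with_norm ℝ (M - P) (M - Q)
  rw [e1, norm_smul, Real.norm_of_nonneg (by norm_num : (0 : ℝ) ≤ 1 / 2)] at hm
  rw [e2] at hp
  have h0 : ‖Q - P‖ * ‖Q - P‖ ≤ 0 := by nlinarith [norm_nonneg (M - P)]
  have h1 : ‖Q - P‖ = 0 := mul_self_eq_zero.mp (le_antisymm h0 (mul_self_nonneg _))
  exact (sub_eq_zero.mp (norm_eq_zero.mp h1)).symm

lemma IsProj.eq_proj {n : ℕ} {M P : Matrix (Fin n) (Fin n) ℝ} (hP : IsProj M P) :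
    P = proj M := by
  have h : ∃ P, IsProj M P := ⟨P, hP⟩
  rw [proj, dif_pos h]
  exact hP.unique h.choose_spec

/-- `f : 𝕊ⁿ → ℝ` is `β`-smooth: differentiable with `β`-Lipschitz gradient, with respect to the
Frobenius norm. -/
def IsSmooth {n : ℕ} (β : ℝ) (f : SymMat n → ℝ) : Prop :=
  Differentiable ℝ f ∧ ∀ X Y : SymMat n, ‖gradient f X - gradient f Y‖ ≤ β * ‖X - Y‖

/-- `X` is an optimal solution of `min_{Y ∈ 𝒮ₙ} f(Y)`. -/
def IsOptimal {n : ℕ} (f : SymMat n → ℝ) (X : SymMat n) : Prop :=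
  X.toMat ∈ spectrahedron n ∧
    ∀ Y : SymMat n, Y.toMat ∈ spectrahedron n → f X ≤ f Y

end Spectrahedron

end

/-!
Suppose the projection `P` of `X - η G` had rank larger than `r`. Then `range P` contains a unit
vector `w` of `ker X`. Moving mass of `P` from `w wᵀ` to `y yᵀ`, for any unit vector `y`, does not
decrease the distance to `X - η G`, so `w` minimizes the quadratic form of `P - X + η G` on the unit
sphere (`form_le_of_forall_trace_nonneg`). As `X` and `P` have the same trace, some unit vector `y`
in `range X` satisfies `⟪y, P y⟫ ≤ ⟪y, X y⟫`, and for that `y` minimality yields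
`⟪w, G w⟫ < ⟪y, G y⟫` (`exists_form_lt_of_rank_lt`), whatever the step size.

The spectral gap rules this out. The same exchange argument at the optimum `X*` shows that
`∇f(X*) - μₙ I` vanishes on `range X*`; by a dimension count its form is at least `μₙ₋ᵣ - μₙ` on the
orthogonal complement (`IsOptimal.range_le_ker_shiftedOp`, `IsOptimal.gap_le_form_shiftedOp`).
A `sin Θ` bound (`abs_inner_le_of_ker_of_range`) shows that `range X` and `range X*` differ by an
angle of sine at most `s = ‖X - X*‖ / λᵣ(X*)`. Hence the form of `∇f(X*) - μₙ I` is `O(s²)` at `y`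
and at least `(1 - s²) (μₙ₋ᵣ - μₙ)` at `w` (`form_range_le_and_le_form_ker`). Replacing `G` by
`∇f(X*)` costs at most `ξ + β ‖X - X*‖` for each vector, and the assumed closeness of `X` to `X*`
makes the gap dominate all these errors (`gap_inequality`), so `⟪y, G y⟫ ≤ ⟪w, G w⟫`.
-/

open scoped Matrix.Norms.Frobenius

noncomputable section

namespace Spectrahedron

/-! ### Symmetric operators with nearby ranges -/

section Operators

open Module

variable {E : Type*} [NormedAddCommGroup E] [InnerProductSpace ℝ E]

/-- A positive symmetric operator vanishes where its quadratic form does. -/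
lemma eq_zero_of_form_nonpos {H : E →ₗ[ℝ] E} (hH : H.IsSymmetric)
    (hpos : ∀ z, 0 ≤ inner ℝ z (H z)) {x : E} (hx : inner ℝ x (H x) ≤ 0) : H x = 0 := by
  by_contra hne
  have hp : 0 < ‖H x‖ ^ 2 := by positivity
  set a := ‖H x‖ ^ 2 with ha
  set b := inner ℝ (H x) (H (H x)) with hb
  have hb0 : 0 ≤ b := hpos _
  -- test the form at `x - t • H x` with a small `t > 0`
  have key : ∀ t : ℝ, 0 ≤ inner ℝ x (H x) - 2 * t * a + t ^ 2 * b := fun t => by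
    have h := hpos (x - t • H x)
    have e : inner ℝ (x - t • H x) (H (x - t • H x)) =
        inner ℝ x (H x) - 2 * t * a + t ^ 2 * b := by
      simp only [map_sub, map_smul, inner_sub_left, inner_sub_right, inner_smul_left,
        inner_smul_right, conj_trivial]
      rw [← hH x (H x), real_inner_self_eq_norm_sq]
      ring
    rwa [e] at h
  have h := key (a / (b + 1))
  have e : -2 * (a / (b + 1)) * a + (a / (b + 1)) ^ 2 * b = -(a ^ 2 * (b + 2)) / (b + 1) ^ 2 := by
    field_simp
    ring
  have : 0 < a ^ 2 * (b + 2) / (b + 1) ^ 2 := by positivity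
  rw [neg_div] at e
  linarith

/-- The form of an operator that vanishes at `u` is unchanged by subtracting `u`. -/
lemma form_sub_of_apply_eq_zero {H : E →ₗ[ℝ] E} (hH : H.IsSymmetric) {u : E} (hu : H u = 0)
    (x : E) : inner ℝ (x - u) (H (x - u)) = inner ℝ x (H x) := by
  rw [map_sub, hu, sub_zero, inner_sub_left, ← hH u x, hu, inner_zero_left, sub_zero]

lemma ker_eq_range_orthogonal {T : E →ₗ[ℝ] E} (hT : T.IsSymmetric) :
    LinearMap.ker T = (LinearMap.range T)ᗮ :=
  hT.orthogonal_range.symm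

variable [FiniteDimensional ℝ E]

/-- If the quadratic form of a symmetric operator is at least `c > 0` on a subspace `V` that is
large enough to complement a subspace `K` of the kernel, then it is at least `c` on `Kᗮ`. -/
lemma le_form_of_mem_orthogonal {H : E →ₗ[ℝ] E} (hH : H.IsSymmetric) {K V : Submodule ℝ E}
    (hK : K ≤ LinearMap.ker H) (hdim : finrank ℝ E ≤ finrank ℝ K + finrank ℝ V)
    {c : ℝ} (hc : 0 < c) (hV : ∀ z ∈ V, c * ‖z‖ ^ 2 ≤ inner ℝ z (H z))
    {x : E} (hx : x ∈ Kᗮ) : c * ‖x‖ ^ 2 ≤ inner ℝ x (H x) := by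
  have hdisj : K ⊓ V = ⊥ := by
    rw [eq_bot_iff]
    rintro z ⟨hzK, hzV⟩
    have h := hV z hzV
    rw [LinearMap.mem_ker.1 (hK hzK), inner_zero_right] at h
    have : ‖z‖ ^ 2 ≤ 0 := by nlinarith
    simpa using this
  have htop : K ⊔ V = ⊤ := by
    apply Submodule.eq_top_of_finrank_eq
    have h1 := Submodule.finrank_sup_add_finrank_inf_eq K V
    rw [hdisj, finrank_bot] at h1
    have h2 := Submodule.finrank_le (K ⊔ V)
    omega
  obtain ⟨k, hk, v, hv, hkv⟩ := Submodule.mem_sup.1 (htop ▸ Submodule.mem_top : x ∈ K ⊔ V)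
  have hHk : H k = 0 := hK hk
  have hHx : H x = H v := by rw [← hkv, map_add, hHk, zero_add]
  have hxk : inner ℝ k x = 0 := hx k hk
  have hform : inner ℝ x (H x) = inner ℝ v (H v) := by
    rw [hHx, ← hkv, inner_add_left, ← hH, hHk, inner_zero_left, zero_add]
  have hv' : v = x - k := by rw [← hkv]; abel
  have hnorm : ‖v‖ ^ 2 = ‖x‖ ^ 2 + ‖k‖ ^ 2 := by
    rw [hv', norm_sub_sq_real, real_inner_comm, hxk]; ring
  rw [hform]
  refine le_trans ?_ (hV v hv)
  rw [hnorm]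
  nlinarith [sq_nonneg ‖k‖]

/-- A kernel vector of `T` is almost orthogonal to the range of a nearby operator `S` whose
non-zero spectrum is bounded below (a `sin Θ` bound). -/
lemma abs_inner_le_of_ker_of_range {S T : E →ₗ[ℝ] E} (hT : T.IsSymmetric)
    {l d : ℝ} (hd0 : 0 ≤ d)
    (hS : ∀ x ∈ (LinearMap.ker S)ᗮ, l * ‖x‖ ^ 2 ≤ inner ℝ x (S x))
    (hd : ∀ z, ‖S z - T z‖ ≤ d * ‖z‖) {w u : E} (hw : w ∈ LinearMap.ker T)
    (hu : u ∈ LinearMap.range S) (hl : 0 < l) :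
    l * |inner ℝ w u| ≤ d * ‖w‖ * ‖u‖ := by
  obtain ⟨z₀, rfl⟩ := hu
  -- the preimage is taken orthogonal to the kernel, so that its norm is controlled
  obtain ⟨k, hk, z, hz, rfl⟩ := (LinearMap.ker S).exists_add_mem_mem_orthogonal z₀
  rw [map_add, LinearMap.mem_ker.1 hk, zero_add]
  have hlz : l * ‖z‖ ≤ ‖S z‖ := by
    have h1 := (hS z hz).trans (real_inner_le_norm z (S z))
    rcases (norm_nonneg z).eq_or_lt with h | h
    · rw [← h]; simp
    · exact le_of_mul_le_mul_left (by linarith [h1]) h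
  have hin : inner ℝ w (S z) = inner ℝ w (S z - T z) := by
    rw [inner_sub_right, ← hT w z, LinearMap.mem_ker.1 hw, inner_zero_left, sub_zero]
  rw [hin]
  have h1 : |inner ℝ w (S z - T z)| ≤ ‖w‖ * (d * ‖z‖) :=
    (abs_real_inner_le_norm _ _).trans (mul_le_mul_of_nonneg_left (hd z) (norm_nonneg w))
  calc l * |inner ℝ w (S z - T z)| ≤ l * (‖w‖ * (d * ‖z‖)) := by gcongr
    _ = d * ‖w‖ * (l * ‖z‖) := by ring
    _ ≤ d * ‖w‖ * ‖S z‖ := by gcongr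

/-- If `ker T` and `range S` are almost orthogonal, a kernel vector of `T` lies, up to a small
component `u`, in the orthogonal complement of `range S`. -/
lemma exists_range_component_of_ker {S T : E →ₗ[ℝ] E} {s : ℝ}
    (hst : ∀ w ∈ LinearMap.ker T, ∀ u ∈ LinearMap.range S,
      |inner ℝ w u| ≤ s * ‖w‖ * ‖u‖) {w : E} (hw : w ∈ LinearMap.ker T) :
    ∃ u ∈ LinearMap.range S, w - u ∈ (LinearMap.range S)ᗮ ∧
      (1 - s ^ 2) * ‖w‖ ^ 2 ≤ ‖w - u‖ ^ 2 := by
  obtain ⟨u, hu, v, hv, rfl⟩ := (LinearMap.range S).exists_add_mem_mem_orthogonal w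
  refine ⟨u, hu, by simpa using hv, ?_⟩
  have huv : inner ℝ u v = 0 := hv u hu
  have h1 := (le_abs_self _).trans (hst _ hw u hu)
  rw [inner_add_left, real_inner_comm u v, huv, add_zero, real_inner_self_eq_norm_sq] at h1
  have hn : ‖u + v‖ ^ 2 = ‖u‖ ^ 2 + ‖v‖ ^ 2 := by rw [norm_add_sq_real, huv]; ring
  have h2 : ‖u‖ ^ 2 ≤ s ^ 2 * ‖u + v‖ ^ 2 := by
    rcases (norm_nonneg u).eq_or_lt with h | h
    · rw [← h, zero_pow two_ne_zero]; positivity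
    · have : ‖u‖ ≤ s * ‖u + v‖ := le_of_mul_le_mul_right (by linarith [h1]) h
      calc ‖u‖ ^ 2 ≤ (s * ‖u + v‖) ^ 2 := by gcongr
        _ = _ := by ring
  rw [add_sub_cancel_left]
  linarith

/-- If `ker T` and `range S` are almost orthogonal and the rank of `T` is at most that of `S`, every
vector of the range of `T` is the orthogonal projection of a nearby vector of the range of `S`. -/
lemma exists_near_of_mem_range {S T : E →ₗ[ℝ] E} (hT : T.IsSymmetric)
    {s : ℝ} (hs1 : s < 1) (hst : ∀ w ∈ LinearMap.ker T, ∀ u ∈ LinearMap.range S,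
      |inner ℝ w u| ≤ s * ‖w‖ * ‖u‖)
    (hrank : finrank ℝ (LinearMap.range T) ≤ finrank ℝ (LinearMap.range S))
    {y : E} (hy : y ∈ LinearMap.range T) :
    ∃ x ∈ LinearMap.range S, (1 - s ^ 2) * ‖y - x‖ ^ 2 ≤ s ^ 2 * ‖y‖ ^ 2 := by
  set U := LinearMap.range T
  set Q : LinearMap.range S →ₗ[ℝ] U :=
    (U.orthogonalProjectionOnto : E →ₗ[ℝ] U) ∘ₗ (LinearMap.range S).subtype with hQ
  have hker : ∀ x : E, x - U.orthogonalProjectionOnto x ∈ LinearMap.ker T := fun x => by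
    rw [ker_eq_range_orthogonal hT]
    exact Submodule.sub_starProjection_mem_orthogonal x
  have hinj : Function.Injective Q := by
    rw [← LinearMap.ker_eq_bot, eq_bot_iff]
    intro x hx
    have hx0 : U.orthogonalProjectionOnto (x : E) = 0 := hx
    have h1 := (le_abs_self _).trans (hst x (by simpa [hx0] using hker x) x x.2)
    rw [real_inner_self_eq_norm_sq] at h1
    have : ‖(x : E)‖ ^ 2 ≤ 0 := by nlinarith [sq_nonneg ‖(x : E)‖]
    simpa using this
  have hfin : finrank ℝ (LinearMap.range S) = finrank ℝ U :=
    le_antisymm (LinearMap.finrank_le_finrank_of_injective hinj) hrank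
  obtain ⟨x, hx⟩ := (LinearMap.injective_iff_surjective_of_finrank_eq_finrank hfin).1 hinj ⟨y, hy⟩
  have hxy : ((U.orthogonalProjectionOnto (x : E) : U) : E) = y := congrArg Subtype.val hx
  refine ⟨x, x.2, ?_⟩
  set w : E := x - y with hw
  have hwk : w ∈ LinearMap.ker T := by rw [hw, ← hxy]; exact hker x
  have hyw : inner ℝ y w = 0 := by
    rw [ker_eq_range_orthogonal hT] at hwk
    exact hwk y hy
  have hxe : (x : E) = y + w := by rw [hw]; abel
  have h1 := (le_abs_self _).trans (hst w hwk x x.2)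
  have hn : ‖(x : E)‖ ^ 2 = ‖y‖ ^ 2 + ‖w‖ ^ 2 := by rw [hxe, norm_add_sq_real, hyw]; ring
  have hwx : inner ℝ w (x : E) = ‖w‖ ^ 2 := by
    rw [hxe, inner_add_right, real_inner_comm, hyw, zero_add, real_inner_self_eq_norm_sq]
  rw [hwx] at h1
  have h2 : ‖w‖ ^ 2 ≤ s ^ 2 * ‖(x : E)‖ ^ 2 := by
    rcases (norm_nonneg w).eq_or_lt with h | h
    · rw [← h, zero_pow two_ne_zero]; positivity
    · have : ‖w‖ ≤ s * ‖(x : E)‖ := le_of_mul_le_mul_left (by linarith [h1]) h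
      calc ‖w‖ ^ 2 ≤ (s * ‖(x : E)‖) ^ 2 := by gcongr
        _ = _ := by ring
  rw [norm_sub_rev, ← hw]
  rw [hn] at h2
  linarith

end Operators

/-! ### Matrices as operators on Euclidean space -/

section MatrixForms

open Matrix Module

variable {n : ℕ}

lemma inner_toEuclideanLin (A : Matrix (Fin n) (Fin n) ℝ) (x y : EuclideanSpace ℝ (Fin n)) :
    inner ℝ x (toEuclideanLin A y) = x.ofLp ⬝ᵥ A *ᵥ y.ofLp :=
  inner_toEuclideanCLM A x y

lemma finrank_range_toEuclideanLin (A : Matrix (Fin n) (Fin n) ℝ) :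
    finrank ℝ (LinearMap.range (toEuclideanLin A)) = A.rank := by
  rw [toEuclideanLin_eq_toLin_orthonormal, ← rank_eq_finrank_range_toLin]

lemma trace_eq_sum_form (A : Matrix (Fin n) (Fin n) ℝ)
    (b : OrthonormalBasis (Fin n) ℝ (EuclideanSpace ℝ (Fin n))) :
    A.trace = ∑ i, inner ℝ (b i) (toEuclideanLin A (b i)) := by
  rw [← LinearMap.trace_eq_sum_inner, toEuclideanLin_eq_toLin_orthonormal, trace_toLin_eq]

lemma abs_form_le_specNorm (A : Matrix (Fin n) (Fin n) ℝ) (x : EuclideanSpace ℝ (Fin n)) :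
    |inner ℝ x (toEuclideanLin A x)| ≤ specNorm A * ‖x‖ ^ 2 := by
  have h := (toEuclideanCLM (n := Fin n) (𝕜 := ℝ) A).le_opNorm x
  calc |inner ℝ x (toEuclideanLin A x)| ≤ ‖x‖ * ‖toEuclideanLin A x‖ :=
        abs_real_inner_le_norm _ _
    _ ≤ ‖x‖ * (specNorm A * ‖x‖) := mul_le_mul_of_nonneg_left h (norm_nonneg x)
    _ = specNorm A * ‖x‖ ^ 2 := by ring

lemma norm_toEuclideanLin_le (A : Matrix (Fin n) (Fin n) ℝ) (x : EuclideanSpace ℝ (Fin n)) :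
    ‖toEuclideanLin A x‖ ≤ ‖A‖ * ‖x‖ := by
  have h := frobenius_norm_mul A (replicateCol Unit x.ofLp)
  rw [← replicateCol_mulVec, frobenius_norm_replicateCol, frobenius_norm_replicateCol] at h
  exact h

lemma abs_form_le_norm (A : Matrix (Fin n) (Fin n) ℝ) (x : EuclideanSpace ℝ (Fin n)) :
    |inner ℝ x (toEuclideanLin A x)| ≤ ‖A‖ * ‖x‖ ^ 2 := by
  calc |inner ℝ x (toEuclideanLin A x)| ≤ ‖x‖ * ‖toEuclideanLin A x‖ :=
        abs_real_inner_le_norm _ _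
    _ ≤ ‖x‖ * (‖A‖ * ‖x‖) :=
        mul_le_mul_of_nonneg_left (norm_toEuclideanLin_le A x) (norm_nonneg x)
    _ = ‖A‖ * ‖x‖ ^ 2 := by ring

lemma form_nonneg {P : Matrix (Fin n) (Fin n) ℝ} (hP : P.PosSemidef)
    (x : EuclideanSpace ℝ (Fin n)) : 0 ≤ inner ℝ x (toEuclideanLin P x) := by
  rw [inner_toEuclideanLin]
  simpa using hP.dotProduct_mulVec_nonneg x.ofLp

lemma form_vecMulVec (w x : EuclideanSpace ℝ (Fin n)) :
    inner ℝ x (toEuclideanLin (vecMulVec w.ofLp w.ofLp) x) = (inner ℝ w x) ^ 2 := by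
  rw [inner_toEuclideanLin, vecMulVec_mulVec, EuclideanSpace.inner_eq_star_dotProduct]
  simp [dotProduct_smul, sq, dotProduct_comm]

lemma trace_mul_vecMulVec_transpose (N : Matrix (Fin n) (Fin n) ℝ)
    (x : EuclideanSpace ℝ (Fin n)) :
    (N * (vecMulVec x.ofLp x.ofLp)ᵀ).trace = inner ℝ x (toEuclideanLin N x) := by
  rw [inner_toEuclideanLin, transpose_vecMulVec, mul_vecMulVec, trace_vecMulVec, dotProduct_comm]

lemma trace_vecMulVec_self (x : EuclideanSpace ℝ (Fin n)) :
    (vecMulVec x.ofLp x.ofLp).trace = ‖x‖ ^ 2 := by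
  rw [trace_vecMulVec, ← real_inner_self_eq_norm_sq, EuclideanSpace.inner_eq_star_dotProduct]
  simp

lemma posSemidef_vecMulVec (x : EuclideanSpace ℝ (Fin n)) :
    (vecMulVec x.ofLp x.ofLp).PosSemidef := by
  simpa using posSemidef_vecMulVec_self_star x.ofLp

/-- A small multiple of `w wᵀ` can be subtracted from a positive semidefinite matrix whose range
contains `w`. -/
lemma exists_posSemidef_sub_smul {P : Matrix (Fin n) (Fin n) ℝ} (hP : P.PosSemidef)
    {w : EuclideanSpace ℝ (Fin n)} (hw : w ∈ LinearMap.range (toEuclideanLin P)) :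
    ∃ e : ℝ, 0 < e ∧ (P - e • vecMulVec w.ofLp w.ofLp).PosSemidef := by
  obtain ⟨z, rfl⟩ := hw
  set T := toEuclideanLin P with hT
  have hsym : T.IsSymmetric := isSymmetric_toEuclideanLin_iff.2 hP.isHermitian
  set a := inner ℝ z (T z) with ha
  have ha0 : 0 ≤ a := form_nonneg hP z
  refine ⟨(a + 1)⁻¹, by positivity, PosSemidef.of_dotProduct_mulVec_nonneg ?_ ?_⟩
  · exact hP.isHermitian.sub ((posSemidef_vecMulVec _).smul (by positivity :
      (0 : ℝ) ≤ (a + 1)⁻¹)).isHermitian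
  · intro v
    set x : EuclideanSpace ℝ (Fin n) := WithLp.toLp 2 v with hx
    have key : inner ℝ (T z) x ^ 2 ≤ a * inner ℝ x (T x) := by
      -- Cauchy-Schwarz for the form of `P`, as the sign of a discriminant
      have hq : ∀ t : ℝ, 0 ≤ a * (t * t) + 2 * inner ℝ (T z) x * t + inner ℝ x (T x) := fun t => by
        have h := form_nonneg hP (x + t • z)
        rw [← hT] at h
        have e : inner ℝ (x + t • z) (T (x + t • z)) =
            a * (t * t) + 2 * inner ℝ (T z) x * t + inner ℝ x (T x) := by
          simp only [map_add, map_smul, inner_add_left, inner_add_right, inner_smul_left,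
            inner_smul_right, conj_trivial]
          rw [← hsym z x, real_inner_comm (T z) x]
          ring
        rwa [e] at h
      have := discrim_le_zero hq
      rw [discrim] at this
      linarith
    have h1 : star v ⬝ᵥ (P - (a + 1)⁻¹ • vecMulVec (T z).ofLp (T z).ofLp) *ᵥ v =
        inner ℝ x (T x) - (a + 1)⁻¹ * inner ℝ (T z) x ^ 2 := by
      rw [← form_vecMulVec, hT, inner_toEuclideanLin, inner_toEuclideanLin, sub_mulVec,
        dotProduct_sub, smul_mulVec, dotProduct_smul]
      simp [hx]
    rw [h1, sub_nonneg, inv_mul_le_iff₀ (by positivity)]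
    nlinarith [form_nonneg hP x]

/-- If `P` minimizes the linear functional `Tr (N Qᵀ)` over the spectrahedron, then vectors in the
range of `P` minimize the quadratic form of `N` among vectors of the same norm: otherwise mass
could be moved from `w wᵀ` to `y yᵀ`. -/
lemma form_le_of_forall_trace_nonneg {N P : Matrix (Fin n) (Fin n) ℝ} (hP : P ∈ spectrahedron n)
    (hmin : ∀ Q ∈ spectrahedron n, 0 ≤ (N * (Q - P)ᵀ).trace)
    {w y : EuclideanSpace ℝ (Fin n)} (hw : w ∈ LinearMap.range (toEuclideanLin P))
    (hwy : ‖y‖ = ‖w‖) :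
    inner ℝ w (toEuclideanLin N w) ≤ inner ℝ y (toEuclideanLin N y) := by
  obtain ⟨e, he, hpsd⟩ := exists_posSemidef_sub_smul hP.1 hw
  have hQ : P - e • vecMulVec w.ofLp w.ofLp + e • vecMulVec y.ofLp y.ofLp ∈ spectrahedron n := by
    refine ⟨hpsd.add ((posSemidef_vecMulVec y).smul he.le), ?_⟩
    rw [trace_add, trace_sub, trace_smul, trace_smul, trace_vecMulVec_self, trace_vecMulVec_self,
      hwy, hP.2]
    ring
  have h := hmin _ hQ
  have e1 : P - e • vecMulVec w.ofLp w.ofLp + e • vecMulVec y.ofLp y.ofLp - P =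
      e • vecMulVec y.ofLp y.ofLp - e • vecMulVec w.ofLp w.ofLp := by abel
  rw [e1, transpose_sub, transpose_smul, transpose_smul, Matrix.mul_sub, Matrix.mul_smul,
    Matrix.mul_smul, trace_sub, trace_smul, trace_smul, trace_mul_vecMulVec_transpose,
    trace_mul_vecMulVec_transpose, smul_eq_mul, smul_eq_mul, ← mul_sub] at h
  linarith [nonneg_of_mul_nonneg_right h he]

end MatrixForms

/-! ### Ordered eigenvalues -/

section Eigenvalues

open Matrix Module

variable {n : ℕ}

/-- An orthonormal basis of eigenvectors of `A`, in the order of the eigenvalues `eig A 1`, …,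
`eig A n`. -/
def eigBasis (A : SymMat n) : OrthonormalBasis (Fin n) ℝ (EuclideanSpace ℝ (Fin n)) :=
  ((isSymmetric_toEuclideanLin_iff.mpr A.isHermitian).eigenvectorBasis
    finrank_euclideanSpace).reindex (finCongr (Fintype.card_fin n))

lemma toEuclideanLin_eigBasis (A : SymMat n) (i : Fin n) :
    toEuclideanLin A.toMat (eigBasis A i) = eig A (i + 1) • eigBasis A i := by
  rw [eig, dif_pos ⟨by omega, by omega⟩]
  have h := (isSymmetric_toEuclideanLin_iff.mpr A.isHermitian).apply_eigenvectorBasis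
    finrank_euclideanSpace ((finCongr (Fintype.card_fin n)).symm i)
  simp only [eigBasis, OrthonormalBasis.reindex_apply]
  exact h

lemma eig_antitone (A : SymMat n) {j k : ℕ} (hj : 1 ≤ j) (hjk : j ≤ k) (hk : k ≤ n) :
    eig A k ≤ eig A j := by
  rw [eig, eig, dif_pos ⟨by omega, by omega⟩, dif_pos ⟨by omega, by omega⟩]
  apply A.isHermitian.eigenvalues₀_antitone
  simp only [Fin.mk_le_mk]
  omega

lemma form_eigBasis (A : SymMat n) (i : Fin n) :
    inner ℝ (eigBasis A i) (toEuclideanLin A.toMat (eigBasis A i)) = eig A (i + 1) := by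
  rw [toEuclideanLin_eigBasis, inner_smul_right, real_inner_self_eq_norm_sq,
    (eigBasis A).orthonormal.1 i]
  simp

lemma form_eq_sum_eig (A : SymMat n) (x : EuclideanSpace ℝ (Fin n)) :
    inner ℝ x (toEuclideanLin A.toMat x) =
      ∑ i : Fin n, eig A (i + 1) * inner ℝ (eigBasis A i) x ^ 2 := by
  rw [← (eigBasis A).sum_inner_mul_inner x]
  refine Finset.sum_congr rfl fun i _ => ?_
  have hsym := isSymmetric_toEuclideanLin_iff.mpr A.isHermitian
  rw [← hsym (eigBasis A i) x, toEuclideanLin_eigBasis, inner_smul_left, real_inner_comm]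
  simp only [conj_trivial]
  ring

lemma sum_sq_inner_eigBasis (A : SymMat n) (x : EuclideanSpace ℝ (Fin n)) :
    ∑ i : Fin n, inner ℝ (eigBasis A i) x ^ 2 = ‖x‖ ^ 2 := by
  simpa using (eigBasis A).sum_sq_norm_inner_right x

/-- The smallest eigenvalue bounds the quadratic form from below. -/
lemma eig_last_le_form (A : SymMat n) (x : EuclideanSpace ℝ (Fin n)) :
    eig A n * ‖x‖ ^ 2 ≤ inner ℝ x (toEuclideanLin A.toMat x) := by
  rw [form_eq_sum_eig, ← sum_sq_inner_eigBasis A, Finset.mul_sum]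
  exact Finset.sum_le_sum fun i _ => mul_le_mul_of_nonneg_right
    (eig_antitone A (by omega) (by omega) le_rfl) (sq_nonneg _)

/-- The easy half of the Courant–Fischer theorem: on the span of the first `k` eigenvectors the
quadratic form is at least the `k`-th eigenvalue. -/
lemma exists_finrank_eq_eig_le_form (A : SymMat n) {k : ℕ} (hk : k ≤ n) :
    ∃ V : Submodule ℝ (EuclideanSpace ℝ (Fin n)), finrank ℝ V = k ∧
      ∀ z ∈ V, eig A k * ‖z‖ ^ 2 ≤ inner ℝ z (toEuclideanLin A.toMat z) := by
  set v : Fin k → EuclideanSpace ℝ (Fin n) := fun j => eigBasis A (Fin.castLE hk j) with hv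
  have hli : LinearIndependent ℝ v :=
    (eigBasis A).orthonormal.linearIndependent.comp _ (Fin.castLE_injective hk)
  refine ⟨Submodule.span ℝ (Set.range v), by rw [finrank_span_eq_card hli, Fintype.card_fin], ?_⟩
  intro z hz
  rw [form_eq_sum_eig, ← sum_sq_inner_eigBasis A, Finset.mul_sum]
  refine Finset.sum_le_sum fun i _ => ?_
  rcases lt_or_ge (i : ℕ) k with hi | hi
  · exact mul_le_mul_of_nonneg_right (eig_antitone A (by omega) (by omega) hk) (sq_nonneg _)
  · have hle : Submodule.span ℝ (Set.range v) ≤ (Submodule.span ℝ {eigBasis A i})ᗮ := by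
      rw [Submodule.span_le]
      rintro _ ⟨j, rfl⟩
      rw [SetLike.mem_coe, Submodule.mem_orthogonal_singleton_iff_inner_right]
      refine (eigBasis A).orthonormal.2 fun h => ?_
      have := congrArg Fin.val h
      simp only [Fin.val_castLE] at this
      omega
    have h0 := Submodule.mem_orthogonal_singleton_iff_inner_right.1 (hle hz)
    rw [h0]
    simp

/-- The `r`-th eigenvalue of a positive semidefinite matrix of rank `r ≥ 1` is positive. -/
lemma eig_rank_pos (A : SymMat n) (hA : A.toMat.PosSemidef) (hr : 1 ≤ A.toMat.rank) :
    0 < eig A A.toMat.rank := by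
  set r := A.toMat.rank with hrdef
  have hrn : r ≤ n := by simpa using A.toMat.rank_le_card_width
  have hnonneg : ∀ i : Fin n, 0 ≤ eig A (i + 1) := fun i => by
    rw [← form_eigBasis]; exact form_nonneg hA _
  by_contra hneg
  -- otherwise the range is contained in the span of the first `r - 1` eigenvectors
  set v : Fin (r - 1) → EuclideanSpace ℝ (Fin n) := fun j => eigBasis A (Fin.castLE (by omega) j)
  have hle : LinearMap.range (toEuclideanLin A.toMat) ≤ Submodule.span ℝ (Set.range v) := by
    rw [LinearMap.range_eq_map, ← (eigBasis A).toBasis.span_eq, Submodule.map_span,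
      Submodule.span_le]
    rintro _ ⟨_, ⟨i, rfl⟩, rfl⟩
    rw [OrthonormalBasis.coe_toBasis, toEuclideanLin_eigBasis, SetLike.mem_coe]
    rcases lt_or_ge (i : ℕ) (r - 1) with hi | hi
    · exact Submodule.smul_mem _ _ (Submodule.subset_span ⟨⟨i, hi⟩, rfl⟩)
    · have h1 := eig_antitone A hr (show r ≤ i + 1 by omega) (by omega)
      have h2 : eig A (i + 1) = 0 := le_antisymm (by linarith) (hnonneg i)
      rw [h2, zero_smul]
      exact Submodule.zero_mem _
  have h1 := Submodule.finrank_mono hle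
  have h2 := finrank_range_le_card (R := ℝ) v
  rw [finrank_range_toEuclideanLin, ← hrdef] at h1
  rw [Fintype.card_fin] at h2
  unfold Set.finrank at h2
  omega

/-- On the orthogonal complement of its kernel, a positive semidefinite matrix of rank `r ≥ 1` is
bounded below by its `r`-th eigenvalue. -/
lemma eig_rank_le_form (A : SymMat n) (hA : A.toMat.PosSemidef) (hr : 1 ≤ A.toMat.rank)
    {x : EuclideanSpace ℝ (Fin n)} (hx : x ∈ (LinearMap.ker (toEuclideanLin A.toMat))ᗮ) :
    eig A A.toMat.rank * ‖x‖ ^ 2 ≤ inner ℝ x (toEuclideanLin A.toMat x) := by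
  have hrn : A.toMat.rank ≤ n := by simpa using A.toMat.rank_le_card_width
  obtain ⟨V, hVdim, hV⟩ := exists_finrank_eq_eig_le_form A hrn
  refine le_form_of_mem_orthogonal (isSymmetric_toEuclideanLin_iff.2 A.isHermitian) le_rfl
    (V := V) ?_ (eig_rank_pos A hA hr) hV hx
  rw [hVdim, ← finrank_range_toEuclideanLin, add_comm, LinearMap.finrank_range_add_finrank_ker]

end Eigenvalues

/-! ### First-order optimality conditions -/

section Optimality

open Matrix Module

variable {n : ℕ}

lemma IsOptimal.trace_gradient_nonneg {f : SymMat n → ℝ} {X : SymMat n} (h : IsOptimal f X)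
    (hf : Differentiable ℝ f) {Q : Matrix (Fin n) (Fin n) ℝ} (hQ : Q ∈ spectrahedron n) :
    0 ≤ ((gradient f X).toMat * (Q - X.toMat)ᵀ).trace := by
  have hQs : Q.IsSymm := by
    have := hQ.1.isHermitian
    rwa [IsHermitian, conjTranspose_eq_transpose_of_trivial] at this
  set Y : SymMat n := ⟨Q, hQs⟩
  set s : Set (SymMat n) := {Z | Z.toMat ∈ spectrahedron n} with hs
  have hseg : segment ℝ X Y ⊆ s := by
    rintro _ ⟨a, b, ha, hb, hab, rfl⟩
    exact convex_spectrahedron n h.1 hQ ha hb hab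
  have hmin : IsLocalMinOn f s X :=
    Filter.eventually_of_mem self_mem_nhdsWithin fun Z hZ => h.2 Z hZ
  have h0 := hmin.hasFDerivWithinAt_nonneg (hf X).hasFDerivAt.hasFDerivWithinAt
    (sub_mem_posTangentConeAt_of_segment_subset hseg)
  rw [← inner_gradient_left] at h0
  exact h0

lemma trace_proj_sub_nonneg (hn : 0 < n) (M : Matrix (Fin n) (Fin n) ℝ)
    {Q : Matrix (Fin n) (Fin n) ℝ} (hQ : Q ∈ spectrahedron n) :
    0 ≤ ((proj M - M) * (Q - proj M)ᵀ).trace := by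
  have hP := isProj_proj hn M
  have : Nonempty (spectrahedron n) := ⟨⟨_, hP.1⟩⟩
  have heq : ‖M - proj M‖ = ⨅ w : spectrahedron n, ‖M - w‖ :=
    le_antisymm (le_ciInf fun w => hP.2 w w.2)
      (ciInf_le ⟨0, by rintro _ ⟨_, rfl⟩; positivity⟩ (⟨_, hP.1⟩ : spectrahedron n))
  have h : ((M - proj M) * (Q - proj M)ᵀ).trace ≤ 0 :=
    (norm_eq_iInf_iff_real_inner_le_zero (convex_spectrahedron n) hP.1).1 heq Q hQ
  rw [← neg_sub M, neg_mul, trace_neg]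
  linarith

/-- The operator of `A` shifted by its smallest eigenvalue, the positive semidefinite operator
`A - λₙ(A) I`. -/
def shiftedOp (A : SymMat n) : EuclideanSpace ℝ (Fin n) →ₗ[ℝ] EuclideanSpace ℝ (Fin n) :=
  toEuclideanLin A.toMat - eig A n • LinearMap.id

lemma isSymmetric_shiftedOp (A : SymMat n) : (shiftedOp A).IsSymmetric :=
  (isSymmetric_toEuclideanLin_iff.2 A.isHermitian).sub (LinearMap.IsSymmetric.id.smul (by simp))

lemma form_shiftedOp (A : SymMat n) (z : EuclideanSpace ℝ (Fin n)) :
    inner ℝ z (shiftedOp A z) = inner ℝ z (toEuclideanLin A.toMat z) - eig A n * ‖z‖ ^ 2 := by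
  rw [shiftedOp, LinearMap.sub_apply, inner_sub_right, LinearMap.smul_apply, inner_smul_right,
    LinearMap.id_apply, real_inner_self_eq_norm_sq]

lemma form_shiftedOp_nonneg (A : SymMat n) (z : EuclideanSpace ℝ (Fin n)) :
    0 ≤ inner ℝ z (shiftedOp A z) := by
  rw [form_shiftedOp]
  linarith [eig_last_le_form A z]

/-- At an optimal point the gradient acts on the range of the point as multiplication by its
smallest eigenvalue. -/
lemma IsOptimal.range_le_ker_shiftedOp (hn : 0 < n) {f : SymMat n → ℝ} {X : SymMat n}
    (h : IsOptimal f X) (hf : Differentiable ℝ f) :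
    LinearMap.range (toEuclideanLin X.toMat) ≤ LinearMap.ker (shiftedOp (gradient f X)) := by
  intro u hu
  set A := gradient f X
  refine eq_zero_of_form_nonpos (isSymmetric_shiftedOp A) (form_shiftedOp_nonneg A) ?_
  set v := eigBasis A ⟨n - 1, by omega⟩ with hv
  have hvn : ‖v‖ = 1 := (eigBasis A).orthonormal.1 _
  have hvf : inner ℝ v (toEuclideanLin A.toMat v) = eig A n := by
    rw [hv, form_eigBasis]; congr 1; simp only; omega
  have h1 := form_le_of_forall_trace_nonneg h.1
    (fun Q hQ => h.trace_gradient_nonneg hf hQ) hu (y := ‖u‖ • v) (by simp [norm_smul, hvn])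
  rw [map_smul, inner_smul_left, inner_smul_right, hvf, conj_trivial] at h1
  rw [form_shiftedOp]
  linarith

/-- At an optimal point of rank `r`, the shifted gradient is bounded below by the spectral gap
`μₙ₋ᵣ - μₙ` on the orthogonal complement of the range of the point. -/
lemma IsOptimal.gap_le_form_shiftedOp (hn : 0 < n) {f : SymMat n → ℝ} {X : SymMat n}
    (h : IsOptimal f X) (hf : Differentiable ℝ f)
    (hgap : 0 ≤ eig (gradient f X) (n - X.toMat.rank) - eig (gradient f X) n)
    {x : EuclideanSpace ℝ (Fin n)} (hx : x ∈ (LinearMap.range (toEuclideanLin X.toMat))ᗮ) :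
    (eig (gradient f X) (n - X.toMat.rank) - eig (gradient f X) n) * ‖x‖ ^ 2 ≤
      inner ℝ x (shiftedOp (gradient f X) x) := by
  rcases hgap.eq_or_lt with h0 | hpos
  · rw [← h0, zero_mul]
    exact form_shiftedOp_nonneg _ _
  · obtain ⟨V, hVdim, hV⟩ := exists_finrank_eq_eig_le_form (gradient f X)
      (Nat.sub_le n X.toMat.rank)
    refine le_form_of_mem_orthogonal (isSymmetric_shiftedOp _) (h.range_le_ker_shiftedOp hn hf)
      (V := V) ?_ hpos (fun z hz => ?_) hx
    · rw [finrank_range_toEuclideanLin, hVdim, finrank_euclideanSpace, Fintype.card_fin]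
      omega
    · rw [form_shiftedOp]
      linarith [hV z hz]

end Optimality

/-! ### Vectors separating the ranges of two points of the spectrahedron -/

section Witnesses

open Matrix Module

variable {n : ℕ}

lemma exists_mem_range_form_le {X : SymMat n} {P : Matrix (Fin n) (Fin n) ℝ}
    (hX : X.toMat ∈ spectrahedron n) (hP : P ∈ spectrahedron n) :
    ∃ y ∈ LinearMap.range (toEuclideanLin X.toMat), ‖y‖ = 1 ∧
      inner ℝ y (toEuclideanLin P y) ≤ inner ℝ y (toEuclideanLin X.toMat y) := by
  by_contra! hcon
  -- comparing traces in an eigenbasis of `X`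
  have hXt := trace_eq_sum_form X.toMat (eigBasis X)
  have hPt := trace_eq_sum_form P (eigBasis X)
  simp only [hX.2, hP.2, form_eigBasis] at hXt hPt
  have hpos : ∀ i : Fin n, 0 < eig X (i + 1) →
      eig X (i + 1) < inner ℝ (eigBasis X i) (toEuclideanLin P (eigBasis X i)) := fun i hi => by
    have hmem : eigBasis X i ∈ LinearMap.range (toEuclideanLin X.toMat) :=
      ⟨(eig X (i + 1))⁻¹ • eigBasis X i, by
        rw [map_smul, toEuclideanLin_eigBasis, smul_smul, inv_mul_cancel₀ hi.ne', one_smul]⟩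
    have h := hcon _ hmem ((eigBasis X).orthonormal.1 i)
    rwa [form_eigBasis] at h
  obtain ⟨i, -, hi⟩ : ∃ i ∈ Finset.univ, 0 < eig X ((i : Fin n) + 1) := by
    by_contra! h
    have := Finset.sum_nonpos h
    linarith
  have hlt : ∑ i : Fin n, eig X (i + 1) <
      ∑ i, inner ℝ (eigBasis X i) (toEuclideanLin P (eigBasis X i)) := by
    refine Finset.sum_lt_sum (fun j _ => ?_) ⟨i, Finset.mem_univ i, hpos i hi⟩
    rcases lt_or_ge 0 (eig X (j + 1)) with hj | hj
    · exact (hpos j hj).le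
    · exact hj.trans (form_nonneg hP.1 _)
  linarith

lemma exists_mem_range_mem_ker {P X : Matrix (Fin n) (Fin n) ℝ} (h : X.rank < P.rank) :
    ∃ w ∈ LinearMap.range (toEuclideanLin P), toEuclideanLin X w = 0 ∧ ‖w‖ = 1 := by
  have hne : LinearMap.range (toEuclideanLin P) ⊓ LinearMap.ker (toEuclideanLin X) ≠ ⊥ := by
    intro hbot
    have h1 := Submodule.finrank_sup_add_finrank_inf_eq (LinearMap.range (toEuclideanLin P))
      (LinearMap.ker (toEuclideanLin X))
    rw [hbot, finrank_bot, finrank_range_toEuclideanLin] at h1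
    have h2 := LinearMap.finrank_range_add_finrank_ker (toEuclideanLin X)
    rw [finrank_range_toEuclideanLin] at h2
    have h3 := Submodule.finrank_le
      (LinearMap.range (toEuclideanLin P) ⊔ LinearMap.ker (toEuclideanLin X))
    omega
  obtain ⟨w, ⟨hwP, hwX⟩, hw0⟩ := Submodule.exists_mem_ne_zero_of_ne_bot hne
  refine ⟨‖w‖⁻¹ • w, Submodule.smul_mem _ _ hwP, ?_, ?_⟩
  · rw [map_smul, LinearMap.mem_ker.1 hwX, smul_zero]
  · rw [norm_smul, norm_inv, norm_norm, inv_mul_cancel₀ (norm_ne_zero_iff.2 hw0)]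

lemma form_pos_of_mem_range {P : Matrix (Fin n) (Fin n) ℝ} (hP : P.PosSemidef)
    {w : EuclideanSpace ℝ (Fin n)} (hw : w ∈ LinearMap.range (toEuclideanLin P)) (hw0 : w ≠ 0) :
    0 < inner ℝ w (toEuclideanLin P w) := by
  have hsym : (toEuclideanLin P).IsSymmetric := isSymmetric_toEuclideanLin_iff.2 hP.isHermitian
  by_contra! hle
  have hker : w ∈ LinearMap.ker (toEuclideanLin P) :=
    eq_zero_of_form_nonpos hsym (form_nonneg hP) hle
  rw [ker_eq_range_orthogonal hsym] at hker
  exact hw0 (inner_self_eq_zero.1 (hker w hw))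

/-- If the rank of the projection exceeded that of `X`, the quadratic form of the step direction
would be smaller at some unit vector of `ker X` than at some unit vector of `range X`. -/
lemma exists_form_lt_of_rank_lt (hn : 0 < n) {X : SymMat n} (hX : X.toMat ∈ spectrahedron n)
    (G : Matrix (Fin n) (Fin n) ℝ) {η : ℝ} (hη : 0 < η)
    (hrank : X.toMat.rank < (proj (X.toMat - η • G)).rank) :
    ∃ w y, toEuclideanLin X.toMat w = 0 ∧ ‖w‖ = 1 ∧
      y ∈ LinearMap.range (toEuclideanLin X.toMat) ∧ ‖y‖ = 1 ∧
      inner ℝ w (toEuclideanLin G w) < inner ℝ y (toEuclideanLin G y) := by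
  set M := X.toMat - η • G with hM
  have hP : proj M ∈ spectrahedron n := (isProj_proj hn M).1
  obtain ⟨w, hwP, hwX, hw1⟩ := exists_mem_range_mem_ker hrank
  obtain ⟨y, hyX, hy1, hy⟩ := exists_mem_range_form_le hX hP
  refine ⟨w, y, hwX, hw1, hyX, hy1, ?_⟩
  have h := form_le_of_forall_trace_nonneg hP (fun Q hQ => trace_proj_sub_nonneg hn M hQ) hwP
    (hy1.trans hw1.symm)
  have hwpos := form_pos_of_mem_range hP.1 hwP (by rintro rfl; simp at hw1)
  have e : ∀ z, inner ℝ z (toEuclideanLin (proj M - M) z) = inner ℝ z (toEuclideanLin (proj M) z) -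
      inner ℝ z (toEuclideanLin X.toMat z) + η * inner ℝ z (toEuclideanLin G z) := fun z => by
    rw [hM, ← sub_add, map_add, map_sub, map_smul, LinearMap.add_apply, LinearMap.sub_apply,
      LinearMap.smul_apply, inner_add_right, inner_sub_right, inner_smul_right]
  rw [e, e, hwX, inner_zero_right] at h
  nlinarith

end Witnesses

/-! ### Comparison of quadratic forms -/

section Comparison

open Matrix Module

/-- The spectral gap dominates the errors of the comparison: `b` bounds the gradient estimate, `e`
its deviation from the optimal gradient, `s` the sine of the angle between the ranges, and `p` is
the value of the shifted form at the vector of `range X`. -/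
lemma gap_inequality {b e s g p : ℝ} (hb : 0 < b) (he : 0 ≤ e) (hs : 0 ≤ s)
    (hg : 4 * e + 4 * b * s ≤ g) (hg' : g ≤ 2 * (b + e))
    (hp : (1 - s ^ 2) * p ≤ 2 * (b + e) * s ^ 2) :
    p + 2 * e ≤ g * (1 - s ^ 2) := by
  have hs2 : s ≤ 1 / 2 := by nlinarith
  have hss : s ^ 2 ≤ s / 2 := by nlinarith
  have hss4 : s ^ 2 ≤ 1 / 4 := by nlinarith
  have hp' : p ≤ 4 / 3 * (2 * (b + e) * s ^ 2) := by
    by_contra! hlt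
    have : 0 ≤ 2 * (b + e) * s ^ 2 := by positivity
    nlinarith
  have h1 : b * s ^ 2 ≤ b * (s / 2) := by gcongr
  have h2 : e * s ^ 2 ≤ e * (1 / 4) := by gcongr
  have h3 : (4 * e + 4 * b * s) * (3 / 4) ≤ g * (1 - s ^ 2) := by
    have : 0 ≤ b * s := by positivity
    apply mul_le_mul hg (by linarith) (by norm_num) (by linarith)
  have : 0 ≤ b * s := by positivity
  nlinarith

variable {E : Type*} [NormedAddCommGroup E] [InnerProductSpace ℝ E] [FiniteDimensional ℝ E]

/-- If the form of `H` vanishes on `range S`, is at most `c` and is at least `g` on the complement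
of `range S`, then it is small on `range T` and almost `g` on `ker T`, provided that these
subspaces make a small angle, of sine at most `s`, with the corresponding ones of `S`. -/
lemma form_range_le_and_le_form_ker {S T H : E →ₗ[ℝ] E} (hT : T.IsSymmetric) (hH : H.IsSymmetric)
    {s g c : ℝ} (hs0 : 0 ≤ s) (hs1 : s < 1) (hg : 0 ≤ g) (hc : 0 ≤ c)
    (hst : ∀ w ∈ LinearMap.ker T, ∀ u ∈ LinearMap.range S, |inner ℝ w u| ≤ s * ‖w‖ * ‖u‖)
    (hrank : finrank ℝ (LinearMap.range T) ≤ finrank ℝ (LinearMap.range S))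
    (hker : LinearMap.range S ≤ LinearMap.ker H)
    (hlow : ∀ x ∈ (LinearMap.range S)ᗮ, g * ‖x‖ ^ 2 ≤ inner ℝ x (H x))
    (hup : ∀ z, inner ℝ z (H z) ≤ c * ‖z‖ ^ 2) {w y : E} (hw : w ∈ LinearMap.ker T)
    (hy : y ∈ LinearMap.range T) :
    (1 - s ^ 2) * inner ℝ y (H y) ≤ c * s ^ 2 * ‖y‖ ^ 2 ∧
      g * (1 - s ^ 2) * ‖w‖ ^ 2 ≤ inner ℝ w (H w) := by
  have hs : 0 ≤ 1 - s ^ 2 := by nlinarith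
  constructor
  · obtain ⟨x, hx, hxy⟩ := exists_near_of_mem_range hT hs1 hst hrank hy
    rw [← form_sub_of_apply_eq_zero hH (hker hx) y]
    calc (1 - s ^ 2) * inner ℝ (y - x) (H (y - x)) ≤ (1 - s ^ 2) * (c * ‖y - x‖ ^ 2) :=
          mul_le_mul_of_nonneg_left (hup _) hs
      _ = c * ((1 - s ^ 2) * ‖y - x‖ ^ 2) := by ring
      _ ≤ c * (s ^ 2 * ‖y‖ ^ 2) := mul_le_mul_of_nonneg_left hxy hc
      _ = c * s ^ 2 * ‖y‖ ^ 2 := by ring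
  · obtain ⟨u, hu, hwu, hle⟩ := exists_range_component_of_ker hst hw
    rw [← form_sub_of_apply_eq_zero hH (hker hu) w]
    calc g * (1 - s ^ 2) * ‖w‖ ^ 2 = g * ((1 - s ^ 2) * ‖w‖ ^ 2) := by ring
      _ ≤ g * ‖w - u‖ ^ 2 := mul_le_mul_of_nonneg_left hle hg
      _ ≤ _ := hlow _ hwu

end Comparison

end Spectrahedron
end

open Spectrahedron in
theorem lemma3 (n r : ℕ) (hrn : r < n) (β B ξ : ℝ) (hβ : 0 ≤ β) (hB : 0 < B)
    (f : SymMat n → ℝ) (hconv : ConvexOn ℝ Set.univ f) (hsmooth : IsSmooth β f)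
    (Xopt : SymMat n) (hopt : IsOptimal f Xopt)
    (hrank : Xopt.toMat.rank = r)
    (X : SymMat n) (hX : X.toMat ∈ spectrahedron n)
    (hXrank : X.toMat.rank ≤ r)
    (hdist : ‖X - Xopt‖ ≤ 1 / 4 * (r * β + √(2 * r) * B / eig Xopt r)⁻¹ *
      ((eig (gradient f Xopt) (n - r) - eig (gradient f Xopt) n) - 4 * r * ξ))
    (G : Matrix (Fin n) (Fin n) ℝ)
    (hGξ : specNorm (G - (gradient f X).toMat) ≤ ξ)
    (hGB : specNorm G ≤ B) (η : ℝ) (hη : 0 < η) :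
    (proj (X.toMat - η • G)).rank ≤ r := by
  have hn : 0 < n := by omega
  subst hrank
  set r := Xopt.toMat.rank with hrdef
  have hr : 1 ≤ r := by
    by_contra! h
    have h0 : r = 0 := by omega
    rw [hrdef, ← finrank_range_toEuclideanLin, Submodule.finrank_eq_zero,
      LinearMap.range_eq_bot, LinearEquiv.map_eq_zero_iff] at h0
    have := hopt.1.2
    simp [h0] at this
  have hr' : (1 : ℝ) ≤ r := by exact_mod_cast hr
  set A := gradient f Xopt with hA
  set l := eig Xopt r with hl
  have hl0 : 0 < l := eig_rank_pos Xopt hopt.1.1 hr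
  set d := ‖X - Xopt‖ with hd
  have hd0 : 0 ≤ d := norm_nonneg _
  set g := eig A (n - r) - eig A n with hg
  set s := d / l with hs
  have hs0 : 0 ≤ s := by positivity
  have hξ : 0 ≤ ξ := (norm_nonneg _).trans hGξ
  set e := ξ + β * d with he
  have he0 : 0 ≤ e := by positivity
  -- the closeness assumption, with `r` and `√(2 r)` replaced by the lower bound `1`
  have hgap : 4 * e + 4 * B * s ≤ g := by
    have hC : 0 < r * β + √(2 * r) * B / l := by positivity
    have h1 : 4 * ((r * β + √(2 * r) * B / l) * d) ≤ g - 4 * r * ξ := by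
      have h2 := mul_le_mul_of_nonneg_left hdist hC.le
      have h3 : (r * β + √(2 * r) * B / l) * (1 / 4 * (r * β + √(2 * r) * B / l)⁻¹ *
          (g - 4 * r * ξ)) = 1 / 4 * (g - 4 * r * ξ) := by
        field_simp
      linarith
    have h2 : (r * β + √(2 * r) * B / l) * d = r * (β * d) + √(2 * r) * (B * s) := by
      rw [hs]; ring
    have hsq : 1 ≤ √(2 * r) := Real.one_le_sqrt.2 (by linarith)
    have h3 : β * d ≤ r * (β * d) := le_mul_of_one_le_left (by positivity) hr'
    have h4 : B * s ≤ √(2 * r) * (B * s) := le_mul_of_one_le_left (by positivity) hsq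
    have h5 : ξ ≤ r * ξ := le_mul_of_one_le_left hξ hr'
    linarith
  have hg0 : 0 ≤ g := by linarith [mul_nonneg hB.le hs0]
  -- `G` and the gradient at the optimum differ by at most `e`
  have hdiff : ∀ z : EuclideanSpace ℝ (Fin n),
      |inner ℝ z (Matrix.toEuclideanLin G z) - inner ℝ z (Matrix.toEuclideanLin A.toMat z)| ≤
        e * ‖z‖ ^ 2 := fun z => by
    have h1 := (abs_form_le_specNorm (G - (gradient f X).toMat) z).trans
      (mul_le_mul_of_nonneg_right hGξ (sq_nonneg ‖z‖))
    have h2 := (abs_form_le_norm ((gradient f X).toMat - A.toMat) z).trans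
      (mul_le_mul_of_nonneg_right (hsmooth.2 X Xopt) (sq_nonneg ‖z‖))
    rw [map_sub, LinearMap.sub_apply, inner_sub_right] at h1 h2
    have h3 := abs_add_le
      (inner ℝ z (Matrix.toEuclideanLin G z) -
        inner ℝ z (Matrix.toEuclideanLin (gradient f X).toMat z))
      (inner ℝ z (Matrix.toEuclideanLin (gradient f X).toMat z) -
        inner ℝ z (Matrix.toEuclideanLin A.toMat z))
    rw [sub_add_sub_cancel] at h3
    calc _ ≤ _ := h3
      _ ≤ ξ * ‖z‖ ^ 2 + β * d * ‖z‖ ^ 2 := add_le_add h1 h2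
      _ = e * ‖z‖ ^ 2 := by ring
  have hAbound : ∀ z : EuclideanSpace ℝ (Fin n),
      |inner ℝ z (Matrix.toEuclideanLin A.toMat z)| ≤ (B + e) * ‖z‖ ^ 2 := fun z => by
    have h1 := (abs_form_le_specNorm G z).trans
      (mul_le_mul_of_nonneg_right hGB (sq_nonneg ‖z‖))
    have h2 := hdiff z
    rw [abs_le] at *
    constructor <;> linarith
  have heig : ∀ k, 1 ≤ k → k ≤ n → |eig A k| ≤ B + e := fun k hk1 hkn => by
    have h := hAbound (eigBasis A ⟨k - 1, by omega⟩)
    rw [form_eigBasis, (eigBasis A).orthonormal.1] at h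
    simpa [Nat.sub_add_cancel hk1] using h
  have hlast := abs_le.1 (heig n hn le_rfl)
  have hg2 : g ≤ 2 * (B + e) := by
    have := abs_le.1 (heig (n - r) (by omega) (by omega))
    rw [hg]
    linarith
  have hs1 : s < 1 := by
    by_contra! h
    nlinarith
  by_contra! hcon
  obtain ⟨w, y, hw, hw1, hy, hy1, hlt⟩ :=
    exists_form_lt_of_rank_lt hn hX G hη (hXrank.trans_lt hcon)
  have hT := Matrix.isSymmetric_toEuclideanLin_iff.2 X.isHermitian
  have hst : ∀ w ∈ LinearMap.ker (Matrix.toEuclideanLin X.toMat),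
      ∀ u ∈ LinearMap.range (Matrix.toEuclideanLin Xopt.toMat),
        |inner ℝ w u| ≤ s * ‖w‖ * ‖u‖ := fun w hw u hu => by
    have hclose : ∀ z, ‖Matrix.toEuclideanLin Xopt.toMat z - Matrix.toEuclideanLin X.toMat z‖ ≤
        d * ‖z‖ := fun z => by
      rw [norm_sub_rev, ← LinearMap.sub_apply, ← map_sub]
      exact norm_toEuclideanLin_le (X.toMat - Xopt.toMat) z
    have h := abs_inner_le_of_ker_of_range hT hd0
      (fun x hx => eig_rank_le_form Xopt hopt.1.1 hr hx) hclose hw hu hl0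
    have e1 : s * ‖w‖ * ‖u‖ = (d * ‖w‖ * ‖u‖) / l := by rw [hs]; ring
    rw [e1, le_div_iff₀ hl0]
    linarith
  have hcmp := form_range_le_and_le_form_ker (c := 2 * (B + e)) hT (isSymmetric_shiftedOp A) hs0 hs1
    hg0 (by positivity) hst
    (by rwa [finrank_range_toEuclideanLin, finrank_range_toEuclideanLin])
    (hopt.range_le_ker_shiftedOp hn hsmooth.1)
    (fun x hx => hopt.gap_le_form_shiftedOp hn hsmooth.1 hg0 hx)
    (fun z => by
      rw [form_shiftedOp]
      have := (abs_le.1 (hAbound z)).2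
      nlinarith [sq_nonneg ‖z‖]) hw hy
  rw [hy1, hw1, one_pow, mul_one, mul_one] at hcmp
  have hfinal := gap_inequality hB he0 hs0 hgap hg2 hcmp.1
  have hwle := hcmp.2
  rw [form_shiftedOp, hy1] at hfinal
  rw [form_shiftedOp, hw1] at hwle
  have h1 := (abs_le.1 (hdiff y)).2
  have h2 := (abs_le.1 (hdiff w)).1
  rw [hy1] at h1
  rw [hw1] at h2
  linarith
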